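/- Let $\mathcal M$ be the collection of isometry classes of non-empty compact metric spaces, equipped with the Gromov–Hausdorff distance $d_{\mathrm{GH}}$, and let $\mathcal U\subseteq\mathcal M$ be the collection of isometry classes of compact ultrametric spaces, i.e. those $(X,d_X)$ with $d_X(x,x'')\le\max(d_X(x,x'),d_X(x',x''))$ for all $x,x',x''\in X$, equipped with the restriction of $d_{\mathrm{GH}}$. A geodesic connecting $x$ to $y$ in a metric space $(M,d)$ is a continuous curve $\gamma:[0,1]\to M$ with $\gamma(0)=x$, $\gamma(1)=y$ and $d(\gamma(s),\gamma(t))=|s-t|\,d(\gamma(0),\gamma(1))$ for all $s,t\in[0,1]$; $M$ is a geodesic space if any two of its points are connected by a geodesic. For $(X,d_X)\in\mathcal M$ and $x,x'\in X$ put $$d_X^{(\infty)}(x,x')=\inf\Big\{\max_{0\le i<n} d_X(x_i,x_{i+1})\;:\;n\ge 1,\ x=x_0,x_1,\dots,x_n=x'\in X\Big\},$$ and let $\mathfrak S_\infty(X)\in\mathcal U$ be the metric space obtained from the pseudometric space $(X,d_X^{(\infty)})$ by identifying points at distance $0$. **Theorem.** $(\mathcal U,d_{\mathrm{GH}})$ is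 a geodesic space. Moreover, the map $\mathfrak S_\infty:\mathcal M\to\mathcal U$ is $1$-Lipschitz with respect to $d_{\mathrm{GH}}$, and for all $X,Y\in\mathcal U$ there is a geodesic connecting $X$ to $Y$ in $(\mathcal M,d_{\mathrm{GH}})$, and for every such geodesic $\gamma$ the curve $\mathfrak S_\infty\circ\gamma$ is a geodesic connecting $X$ to $Y$ in $(\mathcal U,d_{\mathrm{GH}})$. -/

import Mathlib

namespace SingleLinkage

open GromovHausdorff

universe u v

/-- The size of the largest step in the chain `x, z₁, …, zₙ, y`, where `[z₁, …, zₙ]` is the given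
(possibly empty) list of intermediate points. -/
def chainMax {X : Type u} [MetricSpace X] : X → List X → X → ℝ
  | x, [], y => dist x y
  | x, z :: l, y => max (dist x z) (chainMax z l y)

/-- The infimum, over all finite chains from `x` to `y`, of the size of the largest step. -/
noncomputable def slDist {X : Type u} [MetricSpace X] (x y : X) : ℝ :=
  ⨅ l : List X, chainMax x l y

section lemmas

theorem chainMax_nonneg {X : Type u} [MetricSpace X] (x : X) (l : List X) (y : X) :
    0 ≤ chainMax x l y := by
  cases l with
  | nil => exact dist_nonneg
  | cons z l => exact le_max_of_le_left dist_nonneg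

theorem chainMax_append {X : Type u} [MetricSpace X] (x y z : X) (l m : List X) :
    chainMax x (l ++ y :: m) z = max (chainMax x l y) (chainMax y m z) := by
  induction l generalizing x with
  | nil => rfl
  | cons a l ih => simp [chainMax, ih, max_assoc]

theorem chainMax_reverse {X : Type u} [MetricSpace X] (x y : X) (l : List X) :
    chainMax y l.reverse x = chainMax x l y := by
  induction l generalizing x with
  | nil => exact dist_comm _ _
  | cons a l ih =>
    rw [List.reverse_cons, chainMax_append, ih]
    simp [chainMax, dist_comm, max_comm]

theorem chainMax_map {X : Type u} {Y : Type v} [MetricSpace X] [MetricSpace Y] (e : X ≃ᵢ Y)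
    (x y : X) (l : List X) : chainMax (e x) (l.map e) (e y) = chainMax x l y := by
  induction l generalizing x with
  | nil => exact e.dist_eq _ _
  | cons a l ih => simp [chainMax, ih, e.dist_eq]

theorem slDist_le {X : Type u} [MetricSpace X] (x y : X) (l : List X) :
    slDist x y ≤ chainMax x l y :=
  ciInf_le ⟨0, by rintro _ ⟨l, rfl⟩; exact chainMax_nonneg x l y⟩ l

theorem slDist_le_dist {X : Type u} [MetricSpace X] (x y : X) : slDist x y ≤ dist x y :=
  slDist_le x y []

theorem slDist_nonneg {X : Type u} [MetricSpace X] (x y : X) : 0 ≤ slDist x y :=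
  le_ciInf fun l => chainMax_nonneg x l y

theorem slDist_self {X : Type u} [MetricSpace X] (x : X) : slDist x x = 0 :=
  le_antisymm ((slDist_le_dist x x).trans (dist_self x).le) (slDist_nonneg x x)

theorem slDist_comm_le {X : Type u} [MetricSpace X] (x y : X) : slDist x y ≤ slDist y x :=
  le_ciInf fun l => chainMax_reverse y x l ▸ slDist_le x y l.reverse

theorem slDist_comm {X : Type u} [MetricSpace X] (x y : X) : slDist x y = slDist y x :=
  le_antisymm (slDist_comm_le x y) (slDist_comm_le y x)

theorem slDist_max {X : Type u} [MetricSpace X] (x y z : X) :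
    slDist x z ≤ max (slDist x y) (slDist y z) := by
  by_contra! h
  obtain ⟨h1, h2⟩ := max_lt_iff.1 h
  obtain ⟨l, hl⟩ := exists_lt_of_ciInf_lt h1
  obtain ⟨m, hm⟩ := exists_lt_of_ciInf_lt h2
  have := slDist_le x z (l ++ y :: m)
  rw [chainMax_append] at this
  exact absurd this (not_le.2 (max_lt hl hm))

theorem slDist_map_le {X : Type u} {Y : Type v} [MetricSpace X] [MetricSpace Y] (e : X ≃ᵢ Y)
    (x y : X) : slDist (e x) (e y) ≤ slDist x y :=
  le_ciInf fun l => chainMax_map e x y l ▸ slDist_le (e x) (e y) (l.map e)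

theorem slDist_map {X : Type u} {Y : Type v} [MetricSpace X] [MetricSpace Y] (e : X ≃ᵢ Y)
    (x y : X) : slDist (e x) (e y) = slDist x y :=
  le_antisymm (slDist_map_le e x y) (by simpa using slDist_map_le e.symm (e x) (e y))

end lemmas

/-- The set `X`, equipped with the pseudometric `slDist` in place of the original metric. -/
def Pre (X : Type u) : Type u := X

noncomputable instance {X : Type u} [MetricSpace X] : PseudoMetricSpace (Pre X) where
  dist x y := slDist (X := X) x y
  dist_self x := slDist_self (X := X) x
  dist_comm x y := slDist_comm (X := X) x y
  dist_triangle x y z := (slDist_max (X := X) x y z).trans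
    (max_le_add_of_nonneg (slDist_nonneg (X := X) x y) (slDist_nonneg (X := X) y z))

instance {X : Type u} [Nonempty X] : Nonempty (Pre X) := ‹Nonempty X›

/-- The identity map from `X` to `Pre X`. -/
def toPre {X : Type u} (x : X) : Pre X := x

theorem toPre_surjective {X : Type u} : Function.Surjective (toPre (X := X)) := fun x => ⟨x, rfl⟩

theorem dist_toPre {X : Type u} [MetricSpace X] (x y : X) :
    dist (toPre x) (toPre y) = slDist x y := rfl

theorem lipschitz_toPre {X : Type u} [MetricSpace X] : LipschitzWith 1 (toPre (X := X)) :=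
  LipschitzWith.mk_one fun x y => (dist_toPre x y).trans_le (slDist_le_dist x y)

instance {X : Type u} [MetricSpace X] [CompactSpace X] : CompactSpace (Pre X) :=
  ⟨toPre_surjective.range_eq ▸ isCompact_range lipschitz_toPre.continuous⟩

/-- The single-linkage space of `X`: the metric space obtained from the pseudometric space
`(X, slDist)` by identifying points at distance zero. -/
abbrev Space (X : Type u) [MetricSpace X] : Type u := SeparationQuotient (Pre X)

instance {X : Type u} [MetricSpace X] [CompactSpace X] : CompactSpace (Space X) :=
  inferInstanceAs (CompactSpace (Quotient (inseparableSetoid (Pre X))))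

/-- The point of the single-linkage space represented by `x`. -/
noncomputable def toSpace {X : Type u} [MetricSpace X] (x : X) : Space X := SeparationQuotient.mk (toPre x)

theorem toSpace_surjective {X : Type u} [MetricSpace X] :
    Function.Surjective (toSpace (X := X)) :=
  SeparationQuotient.surjective_mk.comp toPre_surjective

theorem dist_toSpace {X : Type u} [MetricSpace X] (x y : X) :
    dist (toSpace x) (toSpace y) = slDist x y := rfl

instance {X : Type u} [MetricSpace X] : IsUltrametricDist (Space X) where
  dist_triangle_max x y z := by
    obtain ⟨x, rfl⟩ := toSpace_surjective x
    obtain ⟨y, rfl⟩ := toSpace_surjective y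
    obtain ⟨z, rfl⟩ := toSpace_surjective z
    simpa only [dist_toSpace] using slDist_max x y z

/-- Isometric metric spaces have isometric single-linkage spaces. -/
theorem nonempty_space_isometryEquiv {X : Type u} {Y : Type v} [MetricSpace X] [MetricSpace Y]
    (e : X ≃ᵢ Y) : Nonempty (Space X ≃ᵢ Space Y) := by
  let g : Space X → X := Function.surjInv toSpace_surjective
  have hg : ∀ x, toSpace (g x) = x := Function.surjInv_eq toSpace_surjective
  let f : Space X → Space Y := fun x => toSpace (e (g x))
  have hf : Isometry f := Isometry.of_dist_eq fun x y => by
    rw [dist_toSpace, slDist_map, ← dist_toSpace, hg, hg]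
  have hs : Function.Surjective f := fun y => by
    obtain ⟨y, rfl⟩ := toSpace_surjective y
    refine ⟨toSpace (e.symm y), dist_eq_zero.1 ?_⟩
    rw [dist_toSpace, ← e.apply_symm_apply y, slDist_map, e.apply_symm_apply, ← dist_toSpace, hg,
      dist_self]
  exact ⟨IsometryEquiv.mk' f (Function.surjInv hs) (Function.surjInv_eq hs) hf⟩

theorem isUltrametricDist_of_isometryEquiv {X : Type u} {Y : Type v} [MetricSpace X]
    [MetricSpace Y] [IsUltrametricDist X] (e : X ≃ᵢ Y) : IsUltrametricDist Y where
  dist_triangle_max x y z := by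
    rw [← e.symm.dist_eq x z, ← e.symm.dist_eq x y, ← e.symm.dist_eq y z]
    exact dist_triangle_max _ _ _

theorem nonempty_rep_isometryEquiv (X : Type u) [MetricSpace X] [CompactSpace X] [Nonempty X] :
    Nonempty (X ≃ᵢ (toGHSpace X).Rep) :=
  toGHSpace_eq_toGHSpace_iff_isometryEquiv.1 (toGHSpace X).toGHSpace_rep.symm

/-- The collection of (isometry classes of) nonempty compact ultrametric spaces, as a subspace of
the Gromov–Hausdorff space of all nonempty compact metric spaces: it carries the restriction of
the Gromov–Hausdorff distance. -/
abbrev UltraGHSpace : Type := {p : GHSpace // IsUltrametricDist p.Rep}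

/-- The isometry class of `X` belongs to `UltraGHSpace` exactly when `X` is ultrametric. -/
theorem isUltrametricDist_rep_toGHSpace_iff (X : Type u) [MetricSpace X] [CompactSpace X]
    [Nonempty X] : IsUltrametricDist (toGHSpace X).Rep ↔ IsUltrametricDist X := by
  obtain ⟨e⟩ := nonempty_rep_isometryEquiv X
  exact ⟨fun _ => isUltrametricDist_of_isometryEquiv e.symm,
    fun _ => isUltrametricDist_of_isometryEquiv e⟩

/-- The single-linkage projection from isometry classes of nonempty compact metric spaces to
isometry classes of nonempty compact ultrametric spaces. -/
noncomputable def proj (p : GHSpace) : UltraGHSpace :=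
  ⟨toGHSpace (Space p.Rep), (isUltrametricDist_rep_toGHSpace_iff _).2 inferInstance⟩

/-- The projection sends the class of `X` to the class of the single-linkage space of `X`. -/
theorem proj_toGHSpace (X : Type u) [MetricSpace X] [CompactSpace X] [Nonempty X] :
    (proj (toGHSpace X) : GHSpace) = toGHSpace (Space X) := by
  obtain ⟨e⟩ := nonempty_rep_isometryEquiv X
  exact toGHSpace_eq_toGHSpace_iff_isometryEquiv.2 (nonempty_space_isometryEquiv e.symm)

/-- `γ : [0,1] → M` is a geodesic connecting `x` to `y`. -/
def IsGeodesic {M : Type u} [MetricSpace M] (γ : unitInterval → M) (x y : M) : Prop :=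
  Continuous γ ∧ γ 0 = x ∧ γ 1 = y ∧
    ∀ s t : unitInterval, dist (γ s) (γ t) = |(s : ℝ) - (t : ℝ)| * dist (γ 0) (γ 1)

/-- Any two points of `M` are connected by a geodesic. -/
def IsGeodesicSpace (M : Type u) [MetricSpace M] : Prop :=
  ∀ x y : M, ∃ γ : unitInterval → M, IsGeodesic γ x y

end SingleLinkage

/-! The Gromov–Hausdorff distance is half the least distortion of a correspondence, and for compact
spaces a compact correspondence `R` attains it. Interpolating linearly between the two distances on
`R` gives a curve of spaces of speed at most `dist X Y`, so all of `GHSpace` is geodesic. Single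
linkage does not increase distortion: a chain in one space transfers along a correspondence to the
other, and each step, hence the maximum, changes by at most the distortion. So `proj` is
1-Lipschitz. It fixes ultrametric spaces, where no chain beats the direct step. A 1-Lipschitz
retraction sends geodesics with endpoints in its image to geodesics, and `UltraGHSpace` inherits
geodesics from `GHSpace`. -/

namespace SingleLinkage

open GromovHausdorff Metric Set

universe w

section Correspondence

variable {X : Type u} [MetricSpace X] {Y : Type v} [MetricSpace Y]

/-- The Gromov–Hausdorff distance is at most half the distortion of a correspondence, given by
two surjections from a common index type. -/
theorem ghDist_le_of_surjective [CompactSpace X] [Nonempty X] [CompactSpace Y] [Nonempty Y]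
    {Z : Type w} {f : Z → X} {g : Z → Y} (hf : Function.Surjective f)
    (hg : Function.Surjective g) {ε : ℝ} (hε : 0 ≤ ε)
    (H : ∀ p q, |dist (f p) (f q) - dist (g p) (g q)| ≤ 2 * ε) : ghDist X Y ≤ ε := by
  -- The gluing puts corresponding points at distance `ε + δ`, which must be positive, while `ε` may
  -- be zero.
  refine le_of_forall_pos_le_add fun δ hδ => ?_
  have hpos : 0 < ε + δ := by linarith
  have : Nonempty Z := hf.nonempty
  let _ : MetricSpace (X ⊕ Y) :=
    glueMetricApprox f g (ε + δ) hpos fun p q => (H p q).trans (by linarith)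
  have hl : Isometry (Sum.inl : X → X ⊕ Y) := Isometry.of_dist_eq fun _ _ => rfl
  have hr : Isometry (Sum.inr : Y → X ⊕ Y) := Isometry.of_dist_eq fun _ _ => rfl
  have hglue : ∀ p, dist (Sum.inl (f p) : X ⊕ Y) (Sum.inr (g p)) = ε + δ :=
    glueDist_glued_points f g (ε + δ)
  refine (ghDist_le_hausdorffDist hl hr).trans (hausdorffDist_le_of_mem_dist hpos.le ?_ ?_)
  · rintro _ ⟨x, rfl⟩
    obtain ⟨p, rfl⟩ := hf x
    exact ⟨_, mem_range_self _, (hglue p).le⟩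
  · rintro _ ⟨y, rfl⟩
    obtain ⟨p, rfl⟩ := hg y
    exact ⟨_, mem_range_self _, (dist_comm _ _).trans_le (hglue p).le⟩

/-- The Gromov–Hausdorff distance of two compact spaces is half the distortion of some compact
correspondence between them. -/
theorem exists_isCompact_correspondence (X : Type u) [MetricSpace X] [CompactSpace X] [Nonempty X]
    (Y : Type v) [MetricSpace Y] [CompactSpace Y] [Nonempty Y] :
    ∃ R : Set (X × Y), IsCompact R ∧ (∀ x, ∃ y, (x, y) ∈ R) ∧ (∀ y, ∃ x, (x, y) ∈ R) ∧
      ∀ p ∈ R, ∀ q ∈ R, |dist p.1 q.1 - dist p.2 q.2| ≤ 2 * ghDist X Y := by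
  obtain ⟨f, g, hf, hg, h⟩ := ghDist_eq_hausdorffDist X Y
  have cf := isCompact_range hf.continuous
  have cg := isCompact_range hg.continuous
  have nf := range_nonempty f
  have ng := range_nonempty g
  have fin := hausdorffEDist_ne_top_of_nonempty_of_bounded nf ng cf.isBounded cg.isBounded
  -- Pairs within `ghDist X Y` in an optimal coupling. The non-strict bound makes the set closed; it
  -- projects onto both factors because nearest points exist in compact sets.
  refine ⟨{p | dist (f p.1) (g p.2) ≤ ghDist X Y}, ?_, fun x => ?_, fun y => ?_, ?_⟩
  · exact (isClosed_le ((hf.continuous.comp continuous_fst).dist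
      (hg.continuous.comp continuous_snd)) continuous_const).isCompact
  · obtain ⟨_, ⟨y, rfl⟩, hy⟩ := cg.exists_infDist_eq_dist ng (f x)
    exact ⟨y, hy.symm.trans_le ((infDist_le_hausdorffDist_of_mem (mem_range_self x) fin).trans
      h.ge)⟩
  · obtain ⟨_, ⟨x, rfl⟩, hx⟩ := cf.exists_infDist_eq_dist nf (g y)
    rw [hausdorffEDist_comm] at fin
    rw [hausdorffDist_comm] at h
    exact ⟨x, (dist_comm _ _).trans_le (hx.symm.trans_le
      ((infDist_le_hausdorffDist_of_mem (mem_range_self y) fin).trans h.ge))⟩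
  · intro p hp q hq
    rw [mem_ofPred_eq] at hp hq
    rw [← hf.dist_eq, ← hg.dist_eq, abs_le]
    have h1 := dist_triangle4 (f p.1) (g p.2) (g q.2) (f q.1)
    have h2 := dist_triangle4 (g p.2) (f p.1) (f q.1) (g q.2)
    rw [dist_comm (g q.2)] at h1
    rw [dist_comm (g p.2) (f p.1)] at h2
    constructor <;> linarith

end Correspondence

/-! ### Geodesics by linear interpolation on a correspondence -/

section Interpolation

variable {X : Type u} [MetricSpace X] {Y : Type v} [MetricSpace Y]

/-- The correspondence `R`, with the convex combination of the two distances as pseudometric. -/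
def Interpolation {X : Type u} {Y : Type v} (R : Set (X × Y)) (_t : unitInterval) : Type (max u v) := R

noncomputable instance (R : Set (X × Y)) (t : unitInterval) :
    PseudoMetricSpace (Interpolation R t) where
  dist p q := (1 - t) * dist p.1.1 q.1.1 + t * dist p.1.2 q.1.2
  dist_self p := by simp
  dist_comm p q := by simp only [dist_comm]
  dist_triangle p q r := by
    have h1 := mul_le_mul_of_nonneg_left (dist_triangle p.1.1 q.1.1 r.1.1) (unitInterval.one_minus_nonneg t)
    have h2 := mul_le_mul_of_nonneg_left (dist_triangle p.1.2 q.1.2 r.1.2) t.2.1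
    linarith

/-- The identity map from `R` to `Interpolation R t`. -/
def toInterpolation {X : Type u} {Y : Type v} (R : Set (X × Y)) (t : unitInterval) (p : R) : Interpolation R t := p

theorem toInterpolation_surjective {X : Type u} {Y : Type v} (R : Set (X × Y)) (t : unitInterval) :
    Function.Surjective (toInterpolation R t) := fun p => ⟨p, rfl⟩

theorem dist_toInterpolation (R : Set (X × Y)) (t : unitInterval) (p q : R) :
    dist (toInterpolation R t p) (toInterpolation R t q) =
      (1 - t) * dist p.1.1 q.1.1 + t * dist p.1.2 q.1.2 := rfl

theorem lipschitz_toInterpolation (R : Set (X × Y)) (t : unitInterval) :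
    LipschitzWith 1 (toInterpolation R t) := LipschitzWith.mk_one fun p q => by
  have h1 : dist p.1.1 q.1.1 ≤ dist p q := le_max_left _ _
  have h2 : dist p.1.2 q.1.2 ≤ dist p q := le_max_right _ _
  rw [dist_toInterpolation]
  have h3 := mul_le_mul_of_nonneg_left h1 (unitInterval.one_minus_nonneg t)
  have h4 := mul_le_mul_of_nonneg_left h2 t.2.1
  linarith

/-- The metric quotients of the interpolated pseudometrics on a compact correspondence. -/
theorem exists_interpolation {R : Set (X × Y)} (hR : IsCompact R) (hne : R.Nonempty)
    (t : unitInterval) : ∃ (p : GHSpace) (f : R → p.Rep), Function.Surjective f ∧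
      ∀ a b, dist (f a) (f b) = (1 - t) * dist a.1.1 b.1.1 + t * dist a.1.2 b.1.2 := by
  have : CompactSpace R := isCompact_iff_compactSpace.1 hR
  have : Nonempty R := hne.to_subtype
  -- The quotient is needed at `t = 0` and `t = 1`, where pairs sharing a coordinate can be at
  -- distance zero.
  let g : R → SeparationQuotient (Interpolation R t) :=
    SeparationQuotient.mk ∘ toInterpolation R t
  have hg : Function.Surjective g :=
    SeparationQuotient.surjective_mk.comp (toInterpolation_surjective R t)
  have hc : Continuous g :=
    SeparationQuotient.continuous_mk.comp (lipschitz_toInterpolation R t).continuous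
  have : CompactSpace (SeparationQuotient (Interpolation R t)) :=
    ⟨hg.range_eq ▸ isCompact_range hc⟩
  have : Nonempty (SeparationQuotient (Interpolation R t)) := ‹Nonempty R›.map g
  obtain ⟨e⟩ := nonempty_rep_isometryEquiv (SeparationQuotient (Interpolation R t))
  exact ⟨_, e ∘ g, e.surjective.comp hg, fun a b => e.dist_eq _ _⟩

end Interpolation

/-- A curve whose speed is at most the distance of its endpoints is a geodesic. -/
theorem isGeodesic_of_dist_le {M : Type u} [MetricSpace M] {γ : unitInterval → M} {x y : M}
    (h0 : γ 0 = x) (h1 : γ 1 = y)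
    (h : ∀ s t : unitInterval, dist (γ s) (γ t) ≤ |(s : ℝ) - t| * dist x y) :
    IsGeodesic γ x y := by
  -- If the piece from `s` to `t` were too short, the path through `γ 0`, `γ s`, `γ t`, `γ 1` would
  -- be shorter than `dist x y`.
  have key : ∀ s t : unitInterval, s ≤ t → |(s : ℝ) - t| * dist x y ≤ dist (γ s) (γ t) := by
    intro s t hst
    have hst' : (s : ℝ) ≤ t := hst
    have e0 := h 0 s
    have e1 := h t 1
    have e2 := dist_triangle4 (γ 0) (γ s) (γ t) (γ 1)
    rw [abs_of_nonpos (by simpa using s.2.1)] at e0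
    rw [abs_of_nonpos (by simpa using t.2.2)] at e1
    rw [abs_of_nonpos (by linarith)]
    rw [h0, h1] at e2
    rw [h0] at e0
    rw [h1] at e1
    simp only [Set.Icc.coe_zero, Set.Icc.coe_one] at e0 e1
    linarith
  refine ⟨?_, h0, h1, fun s t => ?_⟩
  · refine (LipschitzWith.of_dist_le_mul (K := ⟨dist x y, dist_nonneg⟩) fun s t => ?_).continuous
    exact (h s t).trans_eq (mul_comm _ _)
  · rw [h0, h1]
    refine le_antisymm (h s t) ?_
    rcases le_total s t with hst | hst
    · exact key s t hst
    · rw [abs_sub_comm, dist_comm (γ s)]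
      exact key t s hst

/-- The Gromov–Hausdorff space is a geodesic space. -/
theorem isGeodesicSpace_gHSpace : IsGeodesicSpace GHSpace := by
  intro X Y
  obtain ⟨R, hR, hX, hY, hdis⟩ := exists_isCompact_correspondence X.Rep Y.Rep
  rw [← dist_ghDist] at hdis
  obtain ⟨x⟩ : Nonempty X.Rep := inferInstance
  obtain ⟨y, hxy⟩ := hX x
  choose γ f hf hdist using exists_interpolation hR ⟨_, hxy⟩
  have hl : Function.Surjective fun p : R => p.1.1 := fun x => (hX x).elim fun y h => ⟨⟨_, h⟩, rfl⟩
  have hr : Function.Surjective fun p : R => p.1.2 := fun y => (hY y).elim fun x h => ⟨⟨_, h⟩, rfl⟩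
  refine ⟨γ, isGeodesic_of_dist_le ?_ ?_ fun s t => ?_⟩
  -- At an end of the interval one coordinate's distance has weight zero, so projecting to the other
  -- coordinate has distortion zero.
  · refine dist_le_zero.1 ((dist_ghDist _ _).trans_le
      (ghDist_le_of_surjective (hf 0) hl le_rfl fun p q => ?_))
    simp [hdist]
  · refine dist_le_zero.1 ((dist_ghDist _ _).trans_le
      (ghDist_le_of_surjective (hf 1) hr le_rfl fun p q => ?_))
    simp [hdist]
  · refine (dist_ghDist _ _).trans_le (ghDist_le_of_surjective (hf s) (hf t) (by positivity)
      fun p q => ?_)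
    rw [hdist, hdist]
    calc _ = |((s : ℝ) - t) * (-(dist p.1.1 q.1.1 - dist p.1.2 q.1.2))| := by congr 1; ring
      _ = |(s : ℝ) - t| * |dist p.1.1 q.1.1 - dist p.1.2 q.1.2| := by rw [abs_mul, abs_neg]
      _ ≤ |(s : ℝ) - t| * (2 * dist X Y) :=
        mul_le_mul_of_nonneg_left (hdis _ p.2 _ q.2) (abs_nonneg _)
      _ = _ := by ring

/-! ### Single linkage as a 1-Lipschitz retraction -/

section Projection

variable {X : Type u} [MetricSpace X] {Y : Type v} [MetricSpace Y]

/-- Adding a constant commutes with `max`, so the error stays `C` however long the chain is. -/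
theorem chainMax_map_le {Z : Type w} {f : Z → X} {g : Z → Y} {C : ℝ}
    (H : ∀ p q, dist (g p) (g q) ≤ dist (f p) (f q) + C) (a b : Z) (l : List Z) :
    chainMax (g a) (l.map g) (g b) ≤ chainMax (f a) (l.map f) (f b) + C := by
  induction l generalizing a with
  | nil => exact H a b
  | cons c l ih =>
    simp only [List.map_cons, chainMax]
    rw [← max_add_add_right]
    exact max_le_max (H a c) (ih c)

theorem slDist_le_add {Z : Type w} {f : Z → X} {g : Z → Y} {C : ℝ} (hf : Function.Surjective f)
    (H : ∀ p q, dist (g p) (g q) ≤ dist (f p) (f q) + C) (a b : Z) :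
    slDist (g a) (g b) ≤ slDist (f a) (f b) + C := by
  rw [← sub_le_iff_le_add]
  refine le_ciInf fun l => ?_
  -- Surjectivity of `f` lifts the chain to `Z`, from where `g` carries it to `Y`.
  obtain ⟨l, rfl⟩ := List.map_surjective_iff.2 hf l
  rw [sub_le_iff_le_add]
  exact (slDist_le _ _ _).trans (chainMax_map_le H a b l)

/-- The single-linkage distance does not increase the distortion of a correspondence. -/
theorem abs_slDist_sub_le {Z : Type w} {f : Z → X} {g : Z → Y} {C : ℝ}
    (hf : Function.Surjective f) (hg : Function.Surjective g)
    (H : ∀ p q, |dist (f p) (f q) - dist (g p) (g q)| ≤ C) (a b : Z) :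
    |slDist (f a) (f b) - slDist (g a) (g b)| ≤ C := by
  have h1 := slDist_le_add (g := g) (C := C) hf (fun p q => by linarith [(abs_le.1 (H p q)).1]) a b
  have h2 := slDist_le_add (g := f) (C := C) hg (fun p q => by linarith [(abs_le.1 (H p q)).2]) a b
  rw [abs_le]
  constructor <;> linarith

theorem ghDist_space_le [CompactSpace X] [Nonempty X] [CompactSpace Y] [Nonempty Y] :
    ghDist (Space X) (Space Y) ≤ ghDist X Y := by
  obtain ⟨R, -, hX, hY, hdis⟩ := exists_isCompact_correspondence X Y
  have hl : Function.Surjective fun p : R => p.1.1 := fun x => (hX x).elim fun y h => ⟨⟨_, h⟩, rfl⟩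
  have hr : Function.Surjective fun p : R => p.1.2 := fun y => (hY y).elim fun x h => ⟨⟨_, h⟩, rfl⟩
  -- An optimal correspondence descends to the single-linkage spaces. `dist_nonneg` applies since
  -- `ghDist` is by definition a distance in `GHSpace`.
  refine ghDist_le_of_surjective (toSpace_surjective.comp hl) (toSpace_surjective.comp hr)
    dist_nonneg fun p q => ?_
  exact abs_slDist_sub_le hl hr (fun p q => hdis _ p.2 _ q.2) p q

theorem lipschitzWith_proj : LipschitzWith 1 proj := LipschitzWith.mk_one fun p q => by
  rw [dist_ghDist p q]
  exact ghDist_space_le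

theorem dist_le_chainMax [IsUltrametricDist X] (x : X) (l : List X) (y : X) :
    dist x y ≤ chainMax x l y := by
  induction l generalizing x with
  | nil => exact le_rfl
  | cons z l ih => exact (dist_triangle_max x z y).trans (max_le_max le_rfl (ih z))

theorem slDist_eq_dist [IsUltrametricDist X] (x y : X) : slDist x y = dist x y :=
  le_antisymm (slDist_le_dist x y) (le_ciInf fun l => dist_le_chainMax x l y)

theorem toGHSpace_space [CompactSpace X] [Nonempty X] [IsUltrametricDist X] :
    toGHSpace (Space X) = toGHSpace X :=
  dist_le_zero.1 <| ghDist_le_of_surjective toSpace_surjective Function.surjective_id le_rfl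
    fun p q => by simp [dist_toSpace, slDist_eq_dist]

theorem proj_coe (p : UltraGHSpace) : proj p = p := by
  have := p.2
  exact Subtype.ext (toGHSpace_space.trans p.1.toGHSpace_rep)

/-- The projection maps geodesics between ultrametric spaces to geodesics. -/
theorem IsGeodesic.proj {γ : unitInterval → GHSpace} {X Y : UltraGHSpace}
    (h : IsGeodesic γ (X : GHSpace) (Y : GHSpace)) :
    IsGeodesic (fun t => SingleLinkage.proj (γ t)) X Y := by
  obtain ⟨-, h0, h1, h⟩ := h
  -- Only the upper speed bound has to be checked; the endpoints are fixed by the projection.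
  refine isGeodesic_of_dist_le (by rw [h0, proj_coe]) (by rw [h1, proj_coe]) fun s t => ?_
  refine (lipschitzWith_proj.dist_le_mul _ _).trans ?_
  rw [h, h0, h1, NNReal.coe_one, one_mul]
  rfl

end Projection

end SingleLinkage

theorem theorem7p14 :
    SingleLinkage.IsGeodesicSpace SingleLinkage.UltraGHSpace ∧
    LipschitzWith 1 SingleLinkage.proj ∧
    ∀ X Y : SingleLinkage.UltraGHSpace,
      (∃ γ : unitInterval → GromovHausdorff.GHSpace,
        SingleLinkage.IsGeodesic γ (X : GromovHausdorff.GHSpace) (Y : GromovHausdorff.GHSpace)) ∧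
      ∀ γ : unitInterval → GromovHausdorff.GHSpace,
        SingleLinkage.IsGeodesic γ (X : GromovHausdorff.GHSpace) (Y : GromovHausdorff.GHSpace) →
        SingleLinkage.IsGeodesic (fun t => SingleLinkage.proj (γ t)) X Y := by
  refine ⟨fun X Y => ?_, SingleLinkage.lipschitzWith_proj,
    fun X Y => ⟨SingleLinkage.isGeodesicSpace_gHSpace _ _, fun _ h => h.proj⟩⟩
  obtain ⟨γ, h⟩ := SingleLinkage.isGeodesicSpace_gHSpace X Y
  exact ⟨_, h.proj⟩
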